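/- Let $m$ and $n$ be odd primes, not necessarily distinct, and let $q$ be a power of an odd prime. Then the word map $$SL_2(\mathbb F_q)\times SL_2(\mathbb F_q)\to SL_2(\mathbb F_q),\qquad (g_1,g_2)\mapsto g_1^m g_2^n$$ attached to the word $X_1^mX_2^n$ is surjective if and only if $(m,n,q)\neq(3,3,3)$. Moreover, the set of cubes $\{x^3 : x\in SL_2(\mathbb F_3)\}$ is a subgroup of $SL_2(\mathbb F_3)$ of order $8$, isomorphic to the quaternion group $Q_8$. -/

import Mathlib

/-- The word map `G^α → G` attached to a word `w` in the free group on `α`: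
the tuple `g` is sent to the value of `w` at `g`. -/
def wordMap {α : Type*} (w : FreeGroup α) (G : Type*) [Group G] : (α → G) → G :=
  fun g => FreeGroup.lift g w

/-- The word `X₁ ^ m * X₂ ^ n` in the free group on the two letters `X₁ = of 0` and `X₂ = of 1`. -/
def powerWord (m n : ℕ) : FreeGroup (Fin 2) :=
  FreeGroup.of 0 ^ m * FreeGroup.of 1 ^ n

/-!
An element is an `n`-th power as soon as its order is coprime to `n`. In `SL(2, F)` an element of
trace `0` has order dividing `4`, and one of trace `±2` has order dividing `2 * p`, where `p` is the
characteristic. An element `g` of any other trace has order coprime to `q = #F`: since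
`tr (g ^ q) = tr (g) ^ q = tr g`, the matrices `g` and `g ^ q` are conjugate, so they have the same
order.

A noncentral `g` of trace `c` is conjugate to the companion matrix of `X ^ 2 - c * X + 1`, and it is
a product of elements of traces `a` and `b` when `x ^ 2 + c * x * z + z ^ 2 + 1 = a * x + b * z` is
solvable. If `c ≠ ±2`, the pigeonhole principle solves it for `a = b = 0`. If `c = ±2`, then `g` is
itself an `m`-th or an `n`-th power unless `p` divides both exponents; in that case `n` is a power
of `p`, and one takes `a = 0` and any `b` other than `0`, `2` and `-2`, which exists when `q > 3`.
For `q = 3` the cubes form the quaternion subgroup, which then contains every value of the word.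
-/

open Matrix Polynomial MatrixGroups

section WordMap

variable {G H : Type*} [Group G] [Group H]

lemma map_wordMap {α : Type*} (w : FreeGroup α) (f : G →* H) (g : α → G) :
    f (wordMap w G g) = wordMap w H (f ∘ g) :=
  FreeGroup.lift_unique (f.comp (FreeGroup.lift g)) fun a => by simp

lemma wordMap_surjective_of_surjective {α : Type*} {w : FreeGroup α} {f : G →* H}
    (hf : Function.Surjective f) (hw : Function.Surjective (wordMap w G)) :
    Function.Surjective (wordMap w H) := fun h => by
  obtain ⟨g, rfl⟩ := hf h
  obtain ⟨v, rfl⟩ := hw g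
  exact ⟨f ∘ v, (map_wordMap w f v).symm⟩

lemma wordMap_powerWord (m n : ℕ) (v : Fin 2 → G) :
    wordMap (powerWord m n) G v = v 0 ^ m * v 1 ^ n := by
  simp [wordMap, powerWord]

lemma exists_pow_eq_of_coprime_orderOf {g : G} {n : ℕ} (h : (orderOf g).Coprime n) :
    ∃ x, x ^ n = g := by
  obtain ⟨k, hk⟩ := exists_pow_eq_self_of_coprime h.symm
  exact ⟨g ^ k, by rw [pow_right_comm, hk]⟩

lemma mul_mem_range_wordMap_powerWord {m n : ℕ} {a b : G} (ha : (orderOf a).Coprime m)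
    (hb : (orderOf b).Coprime n) : a * b ∈ Set.range (wordMap (powerWord m n) G) := by
  obtain ⟨x, rfl⟩ := exists_pow_eq_of_coprime_orderOf ha
  obtain ⟨y, rfl⟩ := exists_pow_eq_of_coprime_orderOf hb
  exact ⟨![x, y], by simp [wordMap_powerWord]⟩

lemma mem_range_wordMap_powerWord_of_coprime_left {m n : ℕ} {a : G} (ha : (orderOf a).Coprime m) :
    a ∈ Set.range (wordMap (powerWord m n) G) := by
  simpa using mul_mem_range_wordMap_powerWord (b := 1) (n := n) ha (by simp)

lemma mem_range_wordMap_powerWord_of_coprime_right {m n : ℕ} {b : G} (hb : (orderOf b).Coprime n) :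
    b ∈ Set.range (wordMap (powerWord m n) G) := by
  simpa using mul_mem_range_wordMap_powerWord (a := 1) (m := m) (by simp) hb

end WordMap

section Conjugation

/-- Conjugation by an invertible matrix, as an automorphism of the special linear group. -/
def glConj {ι R : Type*} [Fintype ι] [DecidableEq ι] [CommRing R] (P : GL ι R) :
    SpecialLinearGroup ι R ≃* SpecialLinearGroup ι R where
  toFun A := ⟨P.1 * A.1 * P⁻¹.1, by rw [det_units_conj, A.2]⟩
  invFun A := ⟨P⁻¹.1 * A.1 * P.1, by rw [det_units_conj', A.2]⟩
  left_inv A := Subtype.ext <| by simp [mul_assoc]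
  right_inv A := Subtype.ext <| by simp [mul_assoc]
  map_mul' A B := Subtype.ext <|
    show P.1 * (A.1 * B.1) * P⁻¹.1 = P.1 * A.1 * P⁻¹.1 * (P.1 * B.1 * P⁻¹.1) by simp [mul_assoc]

variable {K : Type*} [Field K]

/-- The companion matrix of `X ^ 2 - c * X + 1`, the characteristic polynomial of the elements of
trace `c` of `SL(2, K)`. -/
def companionSL (c : K) : SL(2, K) := ⟨!![0, -1; 1, c], by simp [det_fin_two_of]⟩

lemma exists_mul_eq_mul_companion {M : Matrix (Fin 2) (Fin 2) K}
    (hM : M ∉ Set.range (scalar (Fin 2))) :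
    ∃ P : GL (Fin 2) K, M * P.1 = P.1 * !![0, -M.det; 1, M.trace] := by
  obtain ⟨v, hv⟩ : ∃ v, LinearIndependent K ![v, M *ᵥ v] := by
    by_contra! h
    obtain ⟨a, ha⟩ := LinearMap.exists_eq_smul_id_of_forall_notLinearIndependent
      (f := toLin' M) h
    refine hM ⟨a, toLin'.injective ?_⟩
    rw [ha, scalar_apply, ← smul_one_eq_diagonal, map_smul, toLin'_one]
    rfl
  have hunit : IsUnit (of ![v, M *ᵥ v])ᵀ :=
    (isUnit_transpose _).mpr (linearIndependent_rows_iff_isUnit.mp hv)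
  refine ⟨hunit.unit, ?_⟩
  ext i j
  fin_cases i <;> fin_cases j <;>
    simp only [IsUnit.unit_spec, mulVec_fin_two, mul_apply, transpose_apply, of_apply,
      Fin.sum_univ_two, det_fin_two, trace_fin_two, Fin.zero_eta, Fin.mk_one, Fin.isValue,
      cons_val', cons_val_fin_one, cons_val_zero, cons_val_one] <;>
    ring

lemma exists_glConj_companionSL_eq {g : SL(2, K)} (hg : g.1 ∉ Set.range (scalar (Fin 2))) :
    ∃ P, glConj P (companionSL g.1.trace) = g := by
  obtain ⟨P, hP⟩ := exists_mul_eq_mul_companion hg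
  refine ⟨P, Subtype.ext (P.mul_inv_eq_iff_eq_mul.mpr ?_)⟩
  rw [hP, g.2]
  rfl

lemma exists_mul_eq_companionSL {a b c x z : K}
    (h : x ^ 2 + c * x * z + z ^ 2 + 1 = a * x + b * z) :
    ∃ A B : SL(2, K), A * B = companionSL c ∧ A.1.trace = a ∧ B.1.trace = b := by
  let A : SL(2, K) := ⟨!![x, c * x + z - b; z, a - x], by
    rw [det_fin_two_of]; linear_combination -h⟩
  refine ⟨A, A⁻¹ * companionSL c, mul_inv_cancel_left .., ?_, ?_⟩
  · simp [A, trace_fin_two]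
  · change (A.1.adjugate * !![0, -1; 1, c]).trace = b
    simp only [A, adjugate_fin_two_of, mul_fin_two, trace_fin_two_of]
    ring

lemma exists_mul_eq_of_trace {g : SL(2, K)} (hg : g.1 ∉ Set.range (scalar (Fin 2))) {a b x z : K}
    (h : x ^ 2 + g.1.trace * x * z + z ^ 2 + 1 = a * x + b * z) :
    ∃ A B : SL(2, K), A * B = g ∧ A.1.trace = a ∧ B.1.trace = b := by
  obtain ⟨P, hP⟩ := exists_glConj_companionSL_eq hg
  obtain ⟨A, B, hAB, rfl, rfl⟩ := exists_mul_eq_companionSL h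
  exact ⟨glConj P A, glConj P B, by rw [← map_mul, hAB, hP],
    trace_units_conj .., trace_units_conj ..⟩

end Conjugation

section Order

variable {K : Type*} [Field K] {g : SL(2, K)}

lemma charpoly_SL_two (g : SL(2, K)) : g.1.charpoly = X ^ 2 - C g.1.trace * X + 1 := by
  rw [charpoly_fin_two, g.2, C_1]

lemma orderOf_dvd_of_charpoly_dvd {ι R : Type*} [Fintype ι] [DecidableEq ι] [CommRing R]
    {g : SpecialLinearGroup ι R} {n : ℕ} (h : g.1.charpoly ∣ X ^ n - 1) : orderOf g ∣ n := by
  refine orderOf_dvd_of_pow_eq_one (SpecialLinearGroup.coeMonoidHom_injective ?_)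
  have := aeval_eq_zero_of_dvd_aeval_eq_zero h g.1.aeval_self_charpoly
  simpa [sub_eq_zero] using this

lemma orderOf_dvd_four_of_trace_eq_zero (hg : g.1.trace = 0) : orderOf g ∣ 4 := by
  refine orderOf_dvd_of_charpoly_dvd ⟨X ^ 2 - 1, ?_⟩
  rw [charpoly_SL_two, hg, C_0]
  ring

lemma coprime_orderOf_of_trace_eq_zero {m : ℕ} (hg : g.1.trace = 0) (hm : Odd m) :
    (orderOf g).Coprime m :=
  (hm.coprime_two_left.pow_left 2).coprime_dvd_left (orderOf_dvd_four_of_trace_eq_zero hg)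

lemma orderOf_dvd_two_mul_char_of_trace_sq_eq_four (p : ℕ) [Fact p.Prime] [CharP K p]
    (hg : g.1.trace ^ 2 = 4) : orderOf g ∣ 2 * p := by
  apply orderOf_dvd_of_charpoly_dvd
  have hC : (C g.1.trace : K[X]) ^ 2 = 4 := by rw [← C_pow, hg, C_ofNat]
  calc g.1.charpoly ∣ (X ^ 2 - 1) ^ 2 :=
        ⟨X ^ 2 + C g.1.trace * X + 1, by rw [charpoly_SL_two]; linear_combination X ^ 2 * hC⟩
    _ ∣ (X ^ 2 - 1) ^ p := pow_dvd_pow _ (Fact.out : p.Prime).two_le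
    _ = X ^ (2 * p) - 1 := by rw [sub_pow_char, one_pow, pow_mul]

lemma trace_sq_eq_four_of_mem_range_scalar (hg : g.1 ∈ Set.range (scalar (Fin 2))) :
    g.1.trace ^ 2 = 4 := by
  obtain ⟨a, ha⟩ := hg
  have hdet : a ^ 2 = 1 := by simpa [← ha, sq] using g.2
  rw [← ha, scalar_apply, trace_diagonal]
  simp only [Finset.sum_const, Finset.card_univ, Fintype.card_fin, nsmul_eq_mul, Nat.cast_ofNat]
  linear_combination 4 * hdet

lemma orderOf_dvd_two_of_mem_range_scalar (hg : g.1 ∈ Set.range (scalar (Fin 2))) :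
    orderOf g ∣ 2 := by
  obtain ⟨a, ha⟩ := hg
  have hdet : a ^ 2 = 1 := by simpa [← ha, sq] using g.2
  refine orderOf_dvd_of_pow_eq_one (SpecialLinearGroup.coeMonoidHom_injective ?_)
  rw [map_pow, map_one, SpecialLinearGroup.coeMonoidHom_apply, ← ha, ← map_pow, hdet, map_one]

lemma orderOf_eq_orderOf_companionSL (hg : g.1 ∉ Set.range (scalar (Fin 2))) :
    orderOf g = orderOf (companionSL g.1.trace) := by
  obtain ⟨P, hP⟩ := exists_glConj_companionSL_eq hg
  exact (congrArg orderOf hP).symm.trans (MulEquiv.orderOf_eq (glConj P) _)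

lemma orderOf_eq_of_trace_eq {h : SL(2, K)} (hg : g.1.trace ^ 2 ≠ 4)
    (hgh : g.1.trace = h.1.trace) : orderOf g = orderOf h := by
  have hg' := mt trace_sq_eq_four_of_mem_range_scalar hg
  have hh' : h.1 ∉ Set.range (scalar (Fin 2)) :=
    mt trace_sq_eq_four_of_mem_range_scalar (hgh ▸ hg)
  calc orderOf g = orderOf (companionSL g.1.trace) := orderOf_eq_orderOf_companionSL hg'
    _ = orderOf (companionSL h.1.trace) := by rw [hgh]
    _ = orderOf h := (orderOf_eq_orderOf_companionSL hh').symm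

lemma coprime_orderOf_card_of_trace_sq_ne_four [Finite K] (hg : g.1.trace ^ 2 ≠ 4) :
    (orderOf g).Coprime (Nat.card K) := by
  have := Fintype.ofFinite K
  have htrace : g.1.trace = (g ^ Nat.card K).1.trace := by
    rw [Nat.card_eq_fintype_card]
    calc g.1.trace = g.1.trace ^ Fintype.card K := (FiniteField.pow_card _).symm
      _ = (g.1 ^ Fintype.card K).trace := (FiniteField.trace_pow_card _).symm
      _ = (g ^ Fintype.card K).1.trace :=
        congrArg trace (Matrix.SpecialLinearGroup.coe_pow g _).symm
  have horder : orderOf g = orderOf g / (orderOf g).gcd (Nat.card K) := by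
    rw [← orderOf_pow, ← orderOf_eq_of_trace_eq hg htrace]
  exact (Nat.div_eq_self.mp horder.symm).resolve_left (orderOf_pos g).ne'

end Order

section FiniteField

variable {K : Type*} [Field K]

lemma exists_ne_zero_and_sq_ne_four (hK : 3 < Nat.card K) : ∃ b : K, b ≠ 0 ∧ b ^ 2 ≠ 4 := by
  classical
  have := Nat.finite_of_card_ne_zero (Nat.zero_lt_of_lt hK).ne'
  have := Fintype.ofFinite K
  obtain ⟨b, hb⟩ : ∃ b, b ∉ ({0, 2, -2} : Finset K) := by
    by_contra! h
    have := Finset.card_le_three (a := (0 : K)) (b := 2) (c := -2)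
    rw [Finset.eq_univ_iff_forall.mpr h, Finset.card_univ, ← Nat.card_eq_fintype_card] at this
    omega
  simp only [Finset.mem_insert, Finset.mem_singleton, not_or] at hb
  refine ⟨b, hb.1, fun h => ?_⟩
  rcases sq_eq_sq_iff_eq_or_eq_neg.mp (h.trans (by norm_num : (4 : K) = 2 ^ 2)) with h | h
  exacts [hb.2.1 h, hb.2.2 h]

lemma exists_sq_add_mul_add_sq_add_one_eq_mul {b c : K}
    (hb : b ≠ 0) (hc : c ^ 2 = 4) :
    ∃ x z : K, x ^ 2 + c * x * z + z ^ 2 + 1 = b * z := by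
  rcases sq_eq_sq_iff_eq_or_eq_neg.mp (hc.trans (by norm_num : (4 : K) = 2 ^ 2)) with rfl | rfl
  · exact ⟨-b⁻¹, b⁻¹, by field_simp; ring⟩
  · exact ⟨b⁻¹, b⁻¹, by field_simp; ring⟩

lemma exists_sq_add_mul_add_sq_add_one_eq_zero [Finite K] {c : K} (hc : c ^ 2 ≠ 4) :
    ∃ x z : K, x ^ 2 + c * x * z + z ^ 2 + 1 = 0 := by
  have := Fintype.ofFinite K
  rcases eq_or_ne (ringChar K) 2 with hchar | hchar
  · have h2 : ((2 : ℕ) : K) = 0 := hchar ▸ ringChar.Nat.cast_ringChar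
    exact ⟨1, 0, by push_cast at h2; linear_combination h2⟩
  -- Completing the square diagonalises the form, so that the pigeonhole argument applies.
  obtain ⟨d, rfl⟩ : ∃ d, c = 2 * d :=
    ⟨c / 2, (mul_div_cancel₀ c (Ring.two_ne_zero hchar)).symm⟩
  have hd : 1 - d ^ 2 ≠ 0 := fun h => hc (by linear_combination -4 * h)
  obtain ⟨u, z, huz⟩ := FiniteField.exists_root_sum_quadratic
    (f := C 1 * X ^ 2 + C 0 * X + C 1) (g := C (1 - d ^ 2) * X ^ 2 + C 0 * X + C 0)
    (degree_quadratic one_ne_zero) (degree_quadratic hd)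
    (FiniteField.odd_card_of_char_ne_two hchar)
  refine ⟨u - d * z, z, ?_⟩
  simp only [eval_add, eval_mul, eval_C, eval_pow, eval_X] at huz
  linear_combination huz

end FiniteField

section Surjective

variable {F : Type*} [Field F] [Finite F] {g : SL(2, F)} {m n : ℕ}

lemma exists_mul_eq_of_trace_sq_ne_four (hg : g.1.trace ^ 2 ≠ 4) :
    ∃ A B : SL(2, F), A * B = g ∧ A.1.trace = 0 ∧ B.1.trace = 0 := by
  obtain ⟨x, z, hxz⟩ := exists_sq_add_mul_add_sq_add_one_eq_zero hg
  exact exists_mul_eq_of_trace (mt trace_sq_eq_four_of_mem_range_scalar hg) (x := x) (z := z)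
    (by linear_combination hxz)

lemma exists_mul_eq_of_trace_sq_eq_four (hF : 3 < Nat.card F)
    (hscalar : g.1 ∉ Set.range (scalar (Fin 2))) (hg : g.1.trace ^ 2 = 4) :
    ∃ A B : SL(2, F), A * B = g ∧ A.1.trace = 0 ∧ (orderOf B).Coprime (Nat.card F) := by
  obtain ⟨b, hb, hb4⟩ := exists_ne_zero_and_sq_ne_four hF
  obtain ⟨x, z, hxz⟩ := exists_sq_add_mul_add_sq_add_one_eq_mul hb hg
  obtain ⟨A, B, hAB, hA, rfl⟩ := exists_mul_eq_of_trace hscalar (a := 0) (b := b) (x := x) (z := z)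
    (by linear_combination hxz)
  exact ⟨A, B, hAB, hA, coprime_orderOf_card_of_trace_sq_ne_four hb4⟩

lemma mem_range_wordMap_powerWord_of_trace_sq_eq_four (hm : Odd m) (hn : Odd n)
    (hn' : IsPrimePow n) (h : ¬(3 ∣ m ∧ 3 ∣ n ∧ Nat.card F = 3)) (hg : g.1.trace ^ 2 = 4) :
    g ∈ Set.range (wordMap (powerWord m n) SL(2, F)) := by
  obtain ⟨p, _⟩ := CharP.exists F
  have : Fact p.Prime := ⟨CharP.char_is_prime F p⟩
  have hp : p.Prime := Fact.out
  by_cases hscalar : g.1 ∈ Set.range (scalar (Fin 2))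
  · exact mem_range_wordMap_powerWord_of_coprime_left <|
      hm.coprime_two_left.coprime_dvd_left (orderOf_dvd_two_of_mem_range_scalar hscalar)
  have coprime_of_not_dvd {k : ℕ} (hk : Odd k) (hpk : ¬p ∣ k) : (orderOf g).Coprime k :=
    (hk.coprime_two_left.mul_left (hp.coprime_iff_not_dvd.mpr hpk)).coprime_dvd_left
      (orderOf_dvd_two_mul_char_of_trace_sq_eq_four p hg)
  by_cases hpm : p ∣ m
  swap
  · exact mem_range_wordMap_powerWord_of_coprime_left (coprime_of_not_dvd hm hpm)
  by_cases hpn : p ∣ n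
  swap
  · exact mem_range_wordMap_powerWord_of_coprime_right (coprime_of_not_dvd hn hpn)
  have hpF : p ∣ Nat.card F := by
    have := Fintype.ofFinite F
    obtain ⟨k, -, hk⟩ := FiniteField.card F p
    rw [Nat.card_eq_fintype_card, hk]
    exact dvd_pow_self p k.ne_zero
  have hF : 3 < Nat.card F := by
    have hp3 : 3 ≤ p := hp.two_le.lt_of_ne' fun h2 => hn.not_two_dvd_nat (h2 ▸ hpn)
    refine (hp3.trans (Nat.le_of_dvd Nat.card_pos hpF)).lt_of_ne' fun hF3 => ?_
    obtain rfl := (Nat.prime_dvd_prime_iff_eq hp Nat.prime_three).mp (hF3 ▸ hpF)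
    exact h ⟨hpm, hpn, hF3⟩
  obtain ⟨A, B, rfl, hA, hB⟩ := exists_mul_eq_of_trace_sq_eq_four hF hscalar hg
  refine mul_mem_range_wordMap_powerWord (coprime_orderOf_of_trace_eq_zero hA hm) ?_
  obtain ⟨r, k, hr, -, rfl⟩ := (isPrimePow_nat_iff _).mp hn'
  obtain rfl := (Nat.prime_dvd_prime_iff_eq hp hr).mp (hp.dvd_of_dvd_pow hpn)
  exact (hB.coprime_dvd_right hpF).pow_right k

lemma wordMap_powerWord_surjective (hm : Odd m) (hn : Odd n) (hn' : IsPrimePow n)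
    (h : ¬(3 ∣ m ∧ 3 ∣ n ∧ Nat.card F = 3)) :
    Function.Surjective (wordMap (powerWord m n) SL(2, F)) := fun g => by
  by_cases hg : g.1.trace ^ 2 = 4
  · exact mem_range_wordMap_powerWord_of_trace_sq_eq_four hm hn hn' h hg
  obtain ⟨A, B, rfl, hA, hB⟩ := exists_mul_eq_of_trace_sq_ne_four hg
  exact mul_mem_range_wordMap_powerWord (coprime_orderOf_of_trace_eq_zero hA hm)
    (coprime_orderOf_of_trace_eq_zero hB hn)

end Surjective

section Quaternion

/-- The embedding of the quaternion group of order `8` in `SL(2, ZMod 3)` that sends the generators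
`a 1` and `xa 0` to the matrices `!![0, -1; 1, 0]` and `!![1, 1; 1, -1]`. -/
def quaternionToSL : QuaternionGroup 2 →* SL(2, ZMod 3) where
  toFun
    | .a i => ⟨!![0, -1; 1, 0], by decide⟩ ^ i.val
    | .xa i => ⟨!![1, 1; 1, -1], by decide⟩ * ⟨!![0, -1; 1, 0], by decide⟩ ^ i.val
  map_one' := by decide
  map_mul' := by decide

lemma quaternionToSL_injective : Function.Injective quaternionToSL := by
  decide

lemma pow_three_mem_range_quaternionToSL : ∀ x : SL(2, ZMod 3), x ^ 3 ∈ quaternionToSL.range := by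
  decide

lemma pow_mem_range_quaternionToSL {n : ℕ} (hn : 3 ∣ n) (x : SL(2, ZMod 3)) :
    x ^ n ∈ quaternionToSL.range := by
  obtain ⟨k, rfl⟩ := hn
  rw [pow_mul]
  exact pow_mem (pow_three_mem_range_quaternionToSL x) k

lemma coe_range_quaternionToSL {n : ℕ} (hn : Odd n) (h3n : 3 ∣ n) :
    (quaternionToSL.range : Set SL(2, ZMod 3)) = {g | ∃ x, x ^ n = g} := by
  refine Set.Subset.antisymm ?_ ?_
  · rintro _ ⟨y, rfl⟩
    have hy : orderOf y ∣ 2 ^ 2 := orderOf_dvd_of_pow_eq_one (by decide +revert)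
    obtain ⟨z, rfl⟩ := exists_pow_eq_of_coprime_orderOf
      ((hn.coprime_two_left.pow_left 2).coprime_dvd_left hy)
    exact ⟨quaternionToSL z, (map_pow ..).symm⟩
  · rintro _ ⟨x, rfl⟩
    exact pow_mem_range_quaternionToSL h3n x

lemma card_range_quaternionToSL : Nat.card quaternionToSL.range = 8 := by
  rw [← Nat.card_congr (quaternionToSL.ofInjective quaternionToSL_injective).toEquiv,
    Nat.card_eq_fintype_card, QuaternionGroup.card]

lemma not_surjective_wordMap_powerWord_zmod_three {m n : ℕ} (hm : 3 ∣ m) (hn : 3 ∣ n) :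
    ¬Function.Surjective (wordMap (powerWord m n) SL(2, ZMod 3)) := fun hsurj => by
  obtain ⟨g, hg⟩ : ∃ g, g ∉ quaternionToSL.range := by decide
  obtain ⟨v, rfl⟩ := hsurj g
  rw [wordMap_powerWord] at hg
  exact hg (mul_mem (pow_mem_range_quaternionToSL hm _) (pow_mem_range_quaternionToSL hn _))

lemma not_surjective_wordMap_powerWord_of_card_eq_three {F : Type*} [Field F]
    {m n : ℕ} (hm : 3 ∣ m) (hn : 3 ∣ n) (hF : Nat.card F = 3) :
    ¬Function.Surjective (wordMap (powerWord m n) SL(2, F)) := fun hsurj => by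
  have := Nat.finite_of_card_ne_zero (hF ▸ three_ne_zero)
  have := Fintype.ofFinite F
  let e : F ≃+* ZMod 3 := FiniteField.ringEquivOfCardEq (by
    rw [← Nat.card_eq_fintype_card, hF, ZMod.card])
  have he : Function.Surjective (SpecialLinearGroup.map (n := Fin 2) e.toRingHom) := fun g =>
    ⟨SpecialLinearGroup.map e.symm.toRingHom g, by ext; simp⟩
  exact not_surjective_wordMap_powerWord_zmod_three hm hn
    (wordMap_surjective_of_surjective he hsurj)

end Quaternion

theorem theorem8p9_general :
    (∀ (F : Type*) [Field F] [Finite F] (m n : ℕ), Odd m → Odd n → IsPrimePow n →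
      (Function.Surjective (wordMap (powerWord m n) SL(2, F)) ↔
        ¬(3 ∣ m ∧ 3 ∣ n ∧ Nat.card F = 3))) ∧
    ∃ H : Subgroup SL(2, ZMod 3),
      (∀ n, Odd n → 3 ∣ n → (H : Set SL(2, ZMod 3)) = {g | ∃ x, x ^ n = g}) ∧
      Nat.card H = 8 ∧ Nonempty (H ≃* QuaternionGroup 2) :=
  ⟨fun _ _ _ _ _ hm hn hn' =>
    ⟨fun hsurj ⟨h3m, h3n, hF⟩ =>
      not_surjective_wordMap_powerWord_of_card_eq_three h3m h3n hF hsurj,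
      wordMap_powerWord_surjective hm hn hn'⟩,
    quaternionToSL.range, fun _ => coe_range_quaternionToSL, card_range_quaternionToSL,
    ⟨(quaternionToSL.ofInjective quaternionToSL_injective).symm⟩⟩

theorem theorem8p9 :
    (∀ (F : Type*) [Field F] [Finite F] (m n q : ℕ),
      m.Prime → Odd m → n.Prime → Odd n → Nat.card F = q → Odd q →
      (Function.Surjective
          (wordMap (powerWord m n) (Matrix.SpecialLinearGroup (Fin 2) F)) ↔
        ¬ (m = 3 ∧ n = 3 ∧ q = 3))) ∧
    (∃ H : Subgroup (Matrix.SpecialLinearGroup (Fin 2) (ZMod 3)),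
      (H : Set (Matrix.SpecialLinearGroup (Fin 2) (ZMod 3))) =
        {g | ∃ x : Matrix.SpecialLinearGroup (Fin 2) (ZMod 3), x ^ 3 = g} ∧
      Nat.card H = 8 ∧
      Nonempty (H ≃* QuaternionGroup 2)) := by
  obtain ⟨hsurj, H, hpow, hcard, hiso⟩ := theorem8p9_general
  refine ⟨fun F _ _ m n q hm hmo hn hno hq _ => ?_, H, hpow 3 (by decide) dvd_rfl, hcard, hiso⟩
  rw [hsurj F m n hmo hno hn.isPrimePow, Nat.prime_dvd_prime_iff_eq Nat.prime_three hm,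
    Nat.prime_dvd_prime_iff_eq Nat.prime_three hn, hq, eq_comm (a := 3), eq_comm (a := 3)]
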